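/- Let $X$ be a collectionwise normal space, that is, a $T_1$-space such that for every discrete collection $\mathscr{D}$ of closed subsets of $X$ there is a discrete family $\{U_D : D\in\mathscr{D}\}$ of open subsets of $X$ with $D\subset U_D$ for every $D\in\mathscr{D}$ (an indexed family of subsets is discrete if every point of $X$ has a neighbourhood that meets the members for at most one index). Let $E$ be a Banach space with the metric $d$ generated by its norm, and let $\mathscr{C}'(E)$ consist of all nonempty compact subsets of $E$ together with the set $E$ itself. Let $\varphi : X\to\mathscr{C}'(E)$ be a mapping such that every $\varphi(x)$ is convex and which is lower semi-continuous, i.e. $\{x\in X : \varphi(x)\cap U\neq\emptyset\}$ is open in $X$ for every open $U\subset E$. Let $\varepsilon>0$ and let $g : X\to E$ be a continuous $\varepsilon$-selection for $\varphi$, i.e. a continuous map with $d(g(x),\varphi(x))<\varepsilon$ for every $x\in X$. Then there is a continuous map $f : X\to E$ such that $f(x)\in\varphi(x)$ and $d(f(x),g(x))\le\varepsilon$ for every $x\in X$. -/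

import Mathlib

open Topology

/-- An indexed family of subsets of `X` is discrete if every point of `X` has a neighbourhood which
meets at most one member of the family (members being counted with their indices). -/
def DiscreteFamily {ι X : Type*} [TopologicalSpace X] (F : ι → Set X) : Prop :=
  ∀ x : X, ∃ N ∈ 𝓝 x, {i | (F i ∩ N).Nonempty}.Subsingleton

/-- A space is collectionwise normal if it is `T₁` and every discrete collection `𝒟` of closed
subsets can be expanded to a discrete family `{U D : D ∈ 𝒟}` of open sets with `D ⊆ U D`. -/
class CollectionwiseNormalSpace (X : Type*) [TopologicalSpace X] : Prop extends T1Space X where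
  exists_open_expansion : ∀ 𝒟 : Set (Set X), (∀ D ∈ 𝒟, IsClosed D) →
    DiscreteFamily (fun D : 𝒟 => (D : Set X)) →
    ∃ U : 𝒟 → Set X, (∀ D, IsOpen (U D)) ∧ (∀ D : 𝒟, (D : Set X) ⊆ U D) ∧ DiscreteFamily U

/-- The family `𝒞(E)` of all nonempty compact closed subsets of `E`. -/
def compactMembers (E : Type*) [TopologicalSpace E] : Set (Set E) :=
  {S | S.Nonempty ∧ IsClosed S ∧ IsCompact S}

/-- The family `𝒞'(E) = 𝒞(E) ∪ {E}`. -/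
def compactMembers' (E : Type*) [TopologicalSpace E] : Set (Set E) :=
  compactMembers E ∪ {Set.univ}

/-- A set-valued mapping is lower semi-continuous if `{x | φ x ∩ U ≠ ∅}` is open for every
open `U`. -/
def IsLSC {X E : Type*} [TopologicalSpace X] [TopologicalSpace E] (φ : X → Set E) : Prop :=
  ∀ U : Set E, IsOpen U → IsOpen {x | (φ x ∩ U).Nonempty}

/-- `f` is a selection for `φ`. -/
def IsSelection {X E : Type*} (f : X → E) (φ : X → Set E) : Prop :=
  ∀ x, f x ∈ φ x

/-- `f` is an `ε`-selection for the nonempty-valued mapping `φ`: `d(f(x), φ(x)) < ε` for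
every `x`. -/
def IsEpsSelection {X E : Type*} [PseudoMetricSpace E] (ε : ℝ) (f : X → E) (φ : X → Set E) : Prop :=
  ∀ x, Metric.infDist (f x) (φ x) < ε

open Set

/-! Starting from `g`, one builds maps `f n` in the closed `ε`-tube around `g`, within `ε / 2 ^ n`
of `φ x ∩ ball (g x) ε`, with geometrically small successive distances; their uniform limit is the
selection. To improve `f`, approximate the convex lsc map `ψ x = φ x ∩ ball (g x) ε ∩ ball (f x) r`.
A locally finite cover of `E` by small sets pulls back along `ψ` to open sets of `X`, point-finite
where `φ x` is compact. Where `φ x = E`, `f` is already good enough, because a closed ball is the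
closure of the open one. A radial retraction then returns to the tube, so that this argument applies
again. Gluing over the cover needs no paracompactness of `X`: points of equal finite multiplicity
split into a discrete closed family, which collectionwise normality expands. -/

/-- In a collectionwise normal space every indexed discrete family of closed sets has a discrete
open expansion with the same index set. -/
theorem CollectionwiseNormalSpace.exists_indexed_open_expansion {X ι : Type*} [TopologicalSpace X]
    [CollectionwiseNormalSpace X] (K : ι → Set X) (hK : ∀ i, IsClosed (K i))
    (hd : DiscreteFamily K) :
    ∃ U : ι → Set X, (∀ i, IsOpen (U i)) ∧ (∀ i, K i ⊆ U i) ∧ DiscreteFamily U := by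
  classical
  obtain ⟨U, hUo, hKU, hUd⟩ :=
    CollectionwiseNormalSpace.exists_open_expansion (range K)
      (by rintro _ ⟨i, rfl⟩; exact hK i) (by
        intro x
        obtain ⟨N, hN, hs⟩ := hd x
        refine ⟨N, hN, ?_⟩
        rintro ⟨_, i, rfl⟩ hi ⟨_, j, rfl⟩ hj
        have : i = j := hs hi hj
        subst this
        rfl)
  -- Distinct indices can share a set only when it is empty, so empty members get an empty
  -- expansion.
  refine ⟨fun i => if (K i).Nonempty then U ⟨K i, i, rfl⟩ else ∅, fun i => ?_, fun i x hx => ?_,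
    fun x => ?_⟩
  · dsimp only
    split_ifs
    · exact hUo _
    · exact isOpen_empty
  · have hne : (K i).Nonempty := ⟨x, hx⟩
    simp only [hne, if_true]
    exact hKU ⟨K i, i, rfl⟩ hx
  · obtain ⟨N, hN, hs⟩ := hUd x
    refine ⟨N, hN, ?_⟩
    have key : ∀ i, ((if (K i).Nonempty then U ⟨K i, i, rfl⟩ else ∅) ∩ N).Nonempty →
        (K i).Nonempty ∧ (U ⟨K i, i, rfl⟩ ∩ N).Nonempty := by
      intro i hi
      split_ifs at hi with h
      · exact ⟨h, hi⟩
      · simp at hi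
    intro i hi j hj
    obtain ⟨⟨y, hy⟩, hi'⟩ := key i hi
    obtain ⟨-, hj'⟩ := key j hj
    have hij : K i = K j := congrArg Subtype.val (hs hi' hj')
    obtain ⟨M, hM, hMs⟩ := hd y
    exact hMs ⟨y, hy, mem_of_mem_nhds hM⟩ ⟨y, hij ▸ hy, mem_of_mem_nhds hM⟩

instance CollectionwiseNormalSpace.toNormalSpace {X : Type*} [TopologicalSpace X]
    [CollectionwiseNormalSpace X] : NormalSpace X where
  normal s t hs ht hst := by
    obtain ⟨U, hUo, hKU, hUd⟩ :=
      CollectionwiseNormalSpace.exists_indexed_open_expansion (fun b : Bool => cond b s t)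
        (by rintro (_ | _) <;> assumption) (by
          intro x
          by_cases hx : x ∈ s
          · refine ⟨tᶜ, ht.isOpen_compl.mem_nhds (disjoint_left.1 hst hx), ?_⟩
            rintro (_ | _) hi (_ | _) hj <;> simp_all
          · refine ⟨sᶜ, hs.isOpen_compl.mem_nhds hx, ?_⟩
            rintro (_ | _) hi (_ | _) hj <;> simp_all)
    refine ⟨U true, U false, hUo _, hUo _, hKU true, hKU false, disjoint_left.2 fun x h1 h2 => ?_⟩
    obtain ⟨N, hN, hs⟩ := hUd x
    have := hs ⟨x, h1, mem_of_mem_nhds hN⟩ ⟨x, h2, mem_of_mem_nhds hN⟩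
    simp at this

/-- A Urysohn function that equals one near the closed set and vanishes off the open set. -/
theorem exists_continuous_one_near_zero_off {X : Type*} [TopologicalSpace X] [NormalSpace X]
    {K V : Set X} (hK : IsClosed K) (hV : IsOpen V) (hKV : K ⊆ V) :
    ∃ a : X → ℝ, Continuous a ∧ (∀ x, a x ∈ Icc (0 : ℝ) 1) ∧ K ⊆ interior {x | a x = 1} ∧
      ∀ x, a x ≠ 0 → x ∈ V := by
  obtain ⟨P, hPo, hKP, hPV⟩ := normal_exists_closure_subset hK hV hKV
  obtain ⟨a, ha0, ha1, ha⟩ := exists_continuous_zero_one_of_isClosed hV.isClosed_compl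
    (isClosed_closure (s := P)) (disjoint_left.2 fun x hx hx' => hx (hPV hx'))
  refine ⟨a, a.continuous, ha, hKP.trans (interior_maximal ?_ hPo), fun x hx => ?_⟩
  · exact fun x hx => ha1 (subset_closure hx)
  · by_contra h
    exact hx (ha0 h)

/-! ### Gluing over point-finite open covers -/

section Blocks

variable {X E ι : Type*} [TopologicalSpace X] [NormedAddCommGroup E] [NormedSpace ℝ E]

/-- A function which is locally constant on the cozero set of `a` may be multiplied by `a`. -/
theorem continuous_smul_of_discreteFamily {V : ι → Set X} (hd : DiscreteFamily V) {a : X → ℝ}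
    (ha : Continuous a) (haV : ∀ x, a x ≠ 0 → x ∈ ⋃ i, V i) {c : ι → E} {q : X → E}
    (hq : ∀ i, ∀ x ∈ V i, q x = c i) : Continuous fun x => a x • q x := by
  refine continuous_iff_continuousAt.2 fun x => ?_
  obtain ⟨N, hN, hs⟩ := hd x
  by_cases h : ∃ i, (V i ∩ N).Nonempty
  · obtain ⟨i, hi⟩ := h
    refine ((ha.smul continuous_const).continuousAt (f := fun y => a y • c i)).congr ?_
    filter_upwards [hN] with y hy
    by_cases hay : a y = 0
    · simp [hay]
    · obtain ⟨j, hj⟩ := mem_iUnion.1 (haV y hay)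
      have : j = i := hs ⟨y, hj, hy⟩ hi
      subst this
      rw [hq j y hj]
  · refine (continuousAt_const (y := (0 : E))).congr ?_
    filter_upwards [hN] with y hy
    have hay : a y = 0 := by
      by_contra hay
      obtain ⟨j, hj⟩ := mem_iUnion.1 (haV y hay)
      exact h ⟨j, y, hj, hy⟩
    simp [hay]

/-- The points of `F` that lie in at most `n` of the sets `W i`. -/
def multiplicityAtMost (F : Set X) (W : ι → Set X) (n : ℕ) : Set X :=
  {x ∈ F | ∀ S : Finset ι, (∀ i ∈ S, x ∈ W i) → S.card ≤ n}

theorem isClosed_multiplicityAtMost {F : Set X} (hF : IsClosed F) {W : ι → Set X}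
    (hW : ∀ i, IsOpen (W i)) (n : ℕ) : IsClosed (multiplicityAtMost F W n) := by
  have : multiplicityAtMost F W n =
      F ∩ ⋂ S : Finset ι, {x | (∀ i ∈ S, x ∈ W i) → S.card ≤ n} := by
    ext x; simp [multiplicityAtMost]
  rw [this]
  refine hF.inter (isClosed_iInter fun S => ?_)
  by_cases h : S.card ≤ n
  · simp [h]
  · have : {x | (∀ i ∈ S, x ∈ W i) → S.card ≤ n} = (⋂ i ∈ S, W i)ᶜ := by
      ext x; simp [h]
    rw [this]
    exact (isOpen_biInter_finset fun i _ => hW i).isClosed_compl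

/-- The inductive step in the construction of a partition of unity on a closed set: points of
multiplicity `n + 1` outside of an open set containing those of multiplicity at most `n`. -/
theorem exists_block [CollectionwiseNormalSpace X] {F : Set X} (hF : IsClosed F) {W : ι → Set X}
    (hW : ∀ i, IsOpen (W i)) (e : ι → E) (n : ℕ) (G : Set X)
    (hG : IsOpen G ∧ multiplicityAtMost F W n ⊆ G) :
    ∃ (a : X → ℝ) (q : X → E), Continuous a ∧ (∀ x, a x ∈ Icc (0 : ℝ) 1) ∧
      (Continuous fun x => a x • q x) ∧ (∀ x, a x ≠ 0 → ∃ i, x ∈ W i ∧ q x = e i) ∧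
      multiplicityAtMost F W (n + 1) ⊆ G ∪ interior {x | a x = 1} := by
  classical
  set K : Set X := multiplicityAtMost F W (n + 1) \ G with hKdef
  have hKc : IsClosed K := (isClosed_multiplicityAtMost hF hW _).sdiff hG.1
  have hex : ∀ x ∈ K, ∃ S : Finset ι, S.card = n + 1 ∧ ∀ i, x ∈ W i ↔ i ∈ S := by
    rintro x ⟨⟨hxF, hx⟩, hxG⟩
    have : ¬ ∀ S : Finset ι, (∀ i ∈ S, x ∈ W i) → S.card ≤ n := fun h => hxG (hG.2 ⟨hxF, h⟩)
    push Not at this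
    obtain ⟨S, hS, hc⟩ := this
    have hc' := hx S hS
    refine ⟨S, by omega, fun i => ⟨fun hi => ?_, hS i⟩⟩
    by_contra hiS
    have := hx (insert i S) (by
      intro j hj
      rcases Finset.mem_insert.1 hj with rfl | hj
      · exact hi
      · exact hS j hj)
    rw [Finset.card_insert_of_notMem hiS] at this
    omega
  let J := {S : Finset ι // S.card = n + 1}
  -- Off `G` the multiplicity is exactly `n + 1`, so lying only in sets indexed by `S` forces the
  -- index set to be `S`. This form makes `L S` visibly closed.
  let L : J → Set X := fun S => K ∩ ⋂ i ∈ {i | i ∉ S.1}, (W i)ᶜ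
  have hLeq : ∀ (S : J) (T : J) x, x ∈ L S → (∀ i ∈ T.1, x ∈ W i) → T = S := by
    intro S T x hx hT
    refine Subtype.ext (Finset.eq_of_subset_of_card_le (fun i hi => ?_) (by rw [S.2, T.2]))
    by_contra hiS
    exact (mem_iInter₂.1 hx.2 i hiS) (hT i hi)
  have hLW : ∀ (S : J) x, x ∈ L S → ∀ i ∈ S.1, x ∈ W i := by
    intro S x hx i hi
    obtain ⟨T, hT, hTW⟩ := hex x hx.1
    have : (⟨T, hT⟩ : J) = S := hLeq S ⟨T, hT⟩ x hx fun i hi => (hTW i).2 hi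
    subst this
    exact (hTW i).2 hi
  have hLd : DiscreteFamily L := by
    intro x
    by_cases hx : x ∈ K
    · obtain ⟨T, hT, hTW⟩ := hex x hx
      -- Among the `L S`, this neighbourhood can meet only `L T`.
      refine ⟨⋂ i ∈ T, W i, (isOpen_biInter_finset fun i _ => hW i).mem_nhds
        (mem_iInter₂.2 fun i hi => (hTW i).2 hi), ?_⟩
      have key : ∀ S : J, (L S ∩ ⋂ i ∈ T, W i).Nonempty → (⟨T, hT⟩ : J) = S := by
        rintro S ⟨y, hy, hyT⟩
        exact hLeq S ⟨T, hT⟩ y hy fun i hi => mem_iInter₂.1 hyT i hi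
      intro S hS S' hS'
      rw [← key S hS, ← key S' hS']
    · refine ⟨Kᶜ, hKc.isOpen_compl.mem_nhds hx, ?_⟩
      rintro S ⟨y, hy, hyK⟩
      exact absurd hy.1 hyK
  have hLc : ∀ S, IsClosed (L S) := fun S =>
    hKc.inter (isClosed_biInter fun i _ => (hW i).isClosed_compl)
  obtain ⟨U, hUo, hLU, hUd⟩ :=
    CollectionwiseNormalSpace.exists_indexed_open_expansion L hLc hLd
  let V : J → Set X := fun S => U S ∩ ⋂ i ∈ S.1, W i
  have hVd : DiscreteFamily V := by
    intro x
    obtain ⟨N, hN, hs⟩ := hUd x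
    refine ⟨N, hN, hs.anti ?_⟩
    rintro S ⟨y, hy, hyN⟩
    exact ⟨y, hy.1, hyN⟩
  have hKV : K ⊆ ⋃ S, V S := by
    intro x hx
    obtain ⟨T, hT, hTW⟩ := hex x hx
    have hxL : x ∈ L ⟨T, hT⟩ := ⟨hx, mem_iInter₂.2 fun i hi hxi => hi ((hTW i).1 hxi)⟩
    exact mem_iUnion.2 ⟨⟨T, hT⟩, hLU _ hxL, mem_iInter₂.2 fun i hi => (hTW i).2 hi⟩
  obtain ⟨a, hac, ha, haK, haV⟩ := exists_continuous_one_near_zero_off hKc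
    (isOpen_iUnion fun S => (hUo S).inter (isOpen_biInter_finset fun i _ => hW i)) hKV
  have hne : ∀ S : J, ∃ i, i ∈ S.1 := fun S =>
    Finset.card_pos.1 (by rw [S.2]; omega)
  choose s hs using hne
  let q : X → E := fun x => if h : ∃ S, x ∈ V S then e (s h.choose) else 0
  have hq : ∀ S, ∀ x ∈ V S, q x = e (s S) := by
    intro S x hx
    have h : ∃ S, x ∈ V S := ⟨S, hx⟩
    obtain ⟨N, hN, hsub⟩ := hVd x
    have : h.choose = S :=
      hsub ⟨x, h.choose_spec, mem_of_mem_nhds hN⟩ ⟨x, hx, mem_of_mem_nhds hN⟩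
    simp only [q, dif_pos h, this]
  refine ⟨a, q, hac, ha, continuous_smul_of_discreteFamily hVd hac haV hq, fun x hx => ?_,
    fun x hx => ?_⟩
  · obtain ⟨S, hS⟩ := mem_iUnion.1 (haV x hx)
    exact ⟨s S, mem_iInter₂.1 hS.2 _ (hs S), hq S x hS⟩
  · by_cases hxG : x ∈ G
    · exact Or.inl hxG
    · exact Or.inr (haK ⟨hx, hxG⟩)

/-- Countably many partially defined maps are glued by convex combinations. -/
theorem exists_continuous_convex_gluing (a : ℕ → X → ℝ) (q : ℕ → X → E)
    (hac : ∀ n, Continuous (a n)) (ha : ∀ n x, a n x ∈ Icc (0 : ℝ) 1)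
    (hq : ∀ n, Continuous fun x => a n x • q n x)
    (hcov : ∀ x, ∃ n, x ∈ interior {y | a n y = 1}) :
    ∃ f : X → E, Continuous f ∧
      ∀ x (C : Set E), Convex ℝ C → (∀ n, a n x ≠ 0 → q n x ∈ C) → f x ∈ C := by
  classical
  -- The weights `P k * a k` telescope to `1 - P n`. Once some `a k` equals one, all later terms
  -- vanish, so near each point the sum is finite.
  let P : ℕ → X → ℝ := fun n x => ∏ k ∈ Finset.range n, (1 - a k x)
  let s : ℕ → X → E := fun n x => ∑ k ∈ Finset.range n, P k x • (a k x • q k x)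
  have hsc : ∀ n, Continuous (s n) := fun n =>
    continuous_finsetSum _ fun k _ =>
      (continuous_finsetProd _ fun j _ => continuous_const.sub (hac j)).smul (hq k)
  have hP0 : ∀ k n x, a k x = 1 → k < n → P n x = 0 := fun k n x hk hkn =>
    Finset.prod_eq_zero (Finset.mem_range.2 hkn) (by rw [hk, sub_self])
  have hstable : ∀ k n x, a k x = 1 → k < n → s n x = s (k + 1) x := by
    intro k n x hk hkn
    induction n, hkn using Nat.le_induction with
    | base => rfl
    | succ n hn ih =>
      have : s (n + 1) x = s n x + P n x • (a n x • q n x) := Finset.sum_range_succ _ _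
      rw [this, ih, hP0 k n x hk hn, zero_smul, add_zero]
  have hsame : ∀ k l x, a k x = 1 → a l x = 1 → s (k + 1) x = s (l + 1) x := by
    intro k l x hk hl
    rcases lt_trichotomy k l with h | h | h
    · exact (hstable k (l + 1) x hk (by omega)).symm
    · rw [h]
    · exact hstable l (k + 1) x hl (by omega)
  have hweights : ∀ n x, ∑ k ∈ Finset.range n, P k x * a k x = 1 - P n x := by
    intro n x
    induction n with
    | zero => simp [P]
    | succ n ih =>
      have : P (n + 1) x = P n x * (1 - a n x) := Finset.prod_range_succ _ _
      rw [Finset.sum_range_succ, ih, this]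
      ring
  choose N hN using hcov
  have hN1 : ∀ x, a (N x) x = 1 := fun x =>
    (interior_subset (hN x) : x ∈ {y | a (N x) y = 1})
  refine ⟨fun x => s (N x + 1) x, continuous_iff_continuousAt.2 fun x => ?_, fun x C hC hqC => ?_⟩
  · refine (hsc (N x + 1)).continuousAt.congr ?_
    filter_upwards [isOpen_interior.mem_nhds (hN x)] with y hy
    exact hsame _ _ _ (interior_subset hy : y ∈ {y | a (N x) y = 1}) (hN1 y)
  · have h0 : q (N x) x ∈ C := hqC _ (by rw [hN1]; exact one_ne_zero)
    -- Terms of weight zero may have `q k x` outside `C`; they are replaced by a point of `C`.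
    have hsum : s (N x + 1) x = ∑ k ∈ Finset.range (N x + 1),
        (P k x * a k x) • (if a k x = 0 then q (N x) x else q k x) := by
      refine Finset.sum_congr rfl fun k _ => ?_
      split_ifs with h
      · simp [h]
      · rw [mul_smul]
    change s (N x + 1) x ∈ C
    rw [hsum]
    refine hC.sum_mem (fun k _ => mul_nonneg (Finset.prod_nonneg fun j _ => ?_) (ha k x).1) ?_
      fun k _ => ?_
    · linarith [(ha j x).2]
    · rw [hweights, hP0 (N x) _ x (hN1 x) (Nat.lt_succ_self _), sub_zero]
    · split_ifs with h
      · exact h0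
      · exact hqC k h

/-- A continuous map with values in convex hulls prescribed by an open cover which consists of one
distinguished set `Z` and a family that is point-finite off `Z`. -/
theorem exists_continuous_mem_of_pointFinite [CollectionwiseNormalSpace X] {Z : Set X}
    (hZ : IsOpen Z) {W : ι → Set X} (hW : ∀ i, IsOpen (W i))
    (hfin : ∀ x, x ∉ Z → {i | x ∈ W i}.Finite) (hcov : ∀ x, x ∉ Z → ∃ i, x ∈ W i)
    {g : X → E} (hg : Continuous g) (e : ι → E) :
    ∃ f : X → E, Continuous f ∧ ∀ x (C : Set E), Convex ℝ C → (x ∈ Z → g x ∈ C) →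
      (∀ i, x ∈ W i → e i ∈ C) → f x ∈ C := by
  classical
  have hF : IsClosed Zᶜ := hZ.isClosed_compl
  choose! a q hac ha hq hmem hnext using
    fun n G hG => exists_block (X := X) (E := E) hF hW e n G hG
  -- `G n` is where some earlier block is locally one; block `n` handles only what `G n` misses.
  let G : ℕ → Set X := fun n => Nat.rec ∅ (fun n G => G ∪ interior {x | a n G x = 1}) n
  have hGs : ∀ n, G (n + 1) = G n ∪ interior {x | a n (G n) x = 1} := fun n => rfl
  have hG : ∀ n, IsOpen (G n) ∧ multiplicityAtMost Zᶜ W n ⊆ G n := by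
    intro n
    induction n with
    | zero =>
      refine ⟨isOpen_empty, fun x hx => ?_⟩
      obtain ⟨i, hi⟩ := hcov x hx.1
      have := hx.2 {i} (by simpa using hi)
      simp at this
    | succ n ih =>
      rw [hGs]
      exact ⟨ih.1.union isOpen_interior, hnext n (G n) ih⟩
  have hGsub : ∀ n x, x ∈ G n → ∃ k, x ∈ interior {y | a k (G k) y = 1} := by
    intro n x hx
    induction n with
    | zero => exact hx.elim
    | succ n ih =>
      rw [hGs] at hx
      rcases hx with hx | hx
      · exact ih hx
      · exact ⟨n, hx⟩
  set O : Set X := ⋃ k, interior {y | a k (G k) y = 1} with hOdef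
  have hO : IsOpen O := isOpen_iUnion fun _ => isOpen_interior
  have hOZ : Oᶜ ⊆ Z := by
    intro x hx
    by_contra hxZ
    have hxG : x ∈ G (hfin x hxZ).toFinset.card := (hG _).2 ⟨hxZ, fun S hS =>
      Finset.card_le_card fun i hi => (hfin x hxZ).mem_toFinset.2 (hS i hi)⟩
    exact hx (mem_iUnion.2 (hGsub _ x hxG))
  obtain ⟨u, huc, hu, huO, huZ⟩ :=
    exists_continuous_one_near_zero_off hO.isClosed_compl hZ hOZ
  obtain ⟨f, hf, hfC⟩ := exists_continuous_convex_gluing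
    -- Index zero carries `g`, weighted by `u`, which is one near the set missed by all blocks; the
    -- blocks are shifted by one.
    (fun n => Nat.casesOn n u fun n => a n (G n)) (fun n => Nat.casesOn n g fun n => q n (G n))
    (by rintro (_ | n); exacts [huc, hac n _ (hG n)])
    (by rintro (_ | n); exacts [hu, ha n _ (hG n)])
    (by rintro (_ | n); exacts [huc.smul hg, hq n _ (hG n)])
    (by
      intro x
      by_cases hx : x ∈ O
      · obtain ⟨k, hk⟩ := mem_iUnion.1 hx
        exact ⟨k + 1, hk⟩
      · exact ⟨0, huO hx⟩)
  refine ⟨f, hf, fun x C hC hgC heC => hfC x C hC ?_⟩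
  rintro (_ | n) hn
  · exact hgC (huZ x hn)
  · obtain ⟨i, hi, hqi⟩ := hmem n _ (hG n) x hn
    exact (hqi.symm ▸ heC i hi : q n (G n) x ∈ C)

end Blocks

/-! ### Approximate selections -/

/-- A witness within `r < ε` of `g x` remains admissible while `g` moves by less than `ε - r`. -/
theorem IsLSC.inter_ball {X E : Type*} [TopologicalSpace X] [PseudoMetricSpace E] {φ : X → Set E}
    (hφ : IsLSC φ) {g : X → E} (hg : Continuous g) (ε : ℝ) :
    IsLSC fun x => φ x ∩ Metric.ball (g x) ε := by
  intro U hU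
  refine isOpen_iff_mem_nhds.2 ?_
  rintro x ⟨y, ⟨hy, hyb⟩, hyU⟩
  obtain ⟨r, hr, hrε⟩ := exists_between (Metric.mem_ball.1 hyb)
  have h1 : ∀ᶠ z in 𝓝 x, (φ z ∩ (U ∩ Metric.ball (g x) r)).Nonempty :=
    (hφ _ (hU.inter Metric.isOpen_ball)).mem_nhds ⟨y, hy, hyU, hr⟩
  have h2 : ∀ᶠ z in 𝓝 x, dist (g z) (g x) < ε - r :=
    hg.continuousAt.eventually (Metric.ball_mem_nhds (g x) (sub_pos.2 hrε))
  filter_upwards [h1, h2]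
  rintro z ⟨w, hw, hwU, hwr⟩ hz
  refine ⟨w, ⟨hw, ?_⟩, hwU⟩
  have := dist_triangle_right w (g z) (g x)
  rw [Metric.mem_ball] at hwr ⊢
  linarith

/-- Approximate selections for a convex-valued lower semi-continuous mapping whose values are
relatively compact wherever a given map is not already an approximate selection. -/
theorem IsLSC.exists_continuous_mem_thickening {X E : Type*} [TopologicalSpace X]
    [CollectionwiseNormalSpace X] [NormedAddCommGroup E] [NormedSpace ℝ E] {ψ : X → Set E}
    (hψ : IsLSC ψ) (hne : ∀ x, (ψ x).Nonempty) (hconv : ∀ x, Convex ℝ (ψ x)) {f : X → E}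
    (hf : Continuous f) {δ : ℝ} (hδ : 0 < δ)
    (hcpt : ∀ x, f x ∉ Metric.thickening δ (ψ x) → ∃ C, IsCompact C ∧ ψ x ⊆ C) :
    ∃ f' : X → E, Continuous f' ∧ ∀ x, f' x ∈ Metric.thickening δ (ψ x) := by
  obtain ⟨v, hvo, hvc, hvf, hvb⟩ := precise_refinement (fun e : E => Metric.ball e δ)
    (fun _ => Metric.isOpen_ball)
    (eq_univ_of_forall fun e => mem_iUnion.2 ⟨e, Metric.mem_ball_self hδ⟩)
  have hZiff : ∀ x, x ∈ {x | (ψ x ∩ Metric.ball (f x) δ ∩ univ).Nonempty} ↔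
      f x ∈ Metric.thickening δ (ψ x) := by
    intro x
    simp only [inter_univ, mem_ofPred_eq, Metric.mem_thickening_iff]
    exact ⟨fun ⟨y, hy, hb⟩ => ⟨y, hy, Metric.mem_ball'.1 hb⟩,
      fun ⟨y, hy, hb⟩ => ⟨y, hy, Metric.mem_ball'.2 hb⟩⟩
  obtain ⟨f', hf', h⟩ := exists_continuous_mem_of_pointFinite
    (hψ.inter_ball hf δ univ isOpen_univ) (fun e => hψ (v e) (hvo e))
    (fun x hx => by
      obtain ⟨C, hC, hsub⟩ := hcpt x fun h => hx ((hZiff x).2 h)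
      refine (hvf.finite_nonempty_inter_compact hC).subset ?_
      rintro e ⟨y, hy, hye⟩
      exact ⟨y, hye, hsub hy⟩)
    (fun x _ => by
      obtain ⟨y, hy⟩ := hne x
      obtain ⟨e, he⟩ := mem_iUnion.1 (hvc.symm ▸ mem_univ y : y ∈ ⋃ e, v e)
      exact ⟨e, y, hy, he⟩)
    hf (fun e => e)
  refine ⟨f', hf', fun x => h x _ ((hconv x).thickening δ) (hZiff x).1 ?_⟩
  rintro e ⟨y, hy, hye⟩
  exact Metric.mem_thickening_iff.2 ⟨y, hy, Metric.mem_ball'.1 (hvb e hye)⟩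

/-! ### Radial retraction onto a ball -/

/-- The radial retraction of a normed space onto the closed ball around the origin. -/
noncomputable def radialRetraction {E : Type*} [NormedAddCommGroup E] [NormedSpace ℝ E] (ε : ℝ)
    (v : E) : E :=
  (ε / max ε ‖v‖) • v

section RadialRetraction

variable {E : Type*} [NormedAddCommGroup E] [NormedSpace ℝ E] {ε : ℝ}

theorem continuous_radialRetraction (hε : 0 < ε) :
    Continuous (radialRetraction ε : E → E) :=
  (continuous_const.div (continuous_const.max continuous_norm)
    fun _ => (lt_max_of_lt_left hε).ne').smul continuous_id

theorem norm_radialRetraction_le (hε : 0 < ε) (v : E) : ‖radialRetraction ε v‖ ≤ ε := by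
  have hm : 0 < max ε ‖v‖ := lt_max_of_lt_left hε
  rw [radialRetraction, norm_smul, Real.norm_of_nonneg (by positivity), div_mul_eq_mul_div,
    div_le_iff₀ hm]
  exact mul_le_mul_of_nonneg_left (le_max_right _ _) hε.le

/-- The retraction moves `v` by its excess `‖v‖ - ε` over the radius, or not at all. -/
theorem norm_radialRetraction_sub_le (hε : 0 < ε) {δ : ℝ} (hδ : 0 ≤ δ) {v : E}
    (hv : ‖v‖ ≤ ε + δ) : ‖radialRetraction ε v - v‖ ≤ δ := by
  have hm : 0 < max ε ‖v‖ := lt_max_of_lt_left hε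
  have h : radialRetraction ε v - v = (ε / max ε ‖v‖ - 1) • v := by
    rw [sub_smul, one_smul, radialRetraction]
  have h1 : ε / max ε ‖v‖ ≤ 1 := (div_le_one hm).2 (le_max_left _ _)
  rw [h, norm_smul, Real.norm_of_nonpos (by linarith)]
  rcases le_total ‖v‖ ε with hle | hle
  · rw [max_eq_left hle, div_self hε.ne']
    simpa using hδ
  · rw [max_eq_right hle] at hm ⊢
    have : -(ε / ‖v‖ - 1) * ‖v‖ = ‖v‖ - ε := by
      field_simp
      ring
    linarith

end RadialRetraction

/-! ### Iteration and passage to the limit -/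

/-- Improving an approximate selection that stays within the closed `ε`-tube around `g`. -/
theorem exists_closer_approximate_selection {E : Type*} [NormedAddCommGroup E] [NormedSpace ℝ E]
    {X : Type*} [TopologicalSpace X] [CollectionwiseNormalSpace X]
    {φ : X → Set E} (hφ : ∀ x, φ x ∈ compactMembers' E) (hlsc : IsLSC φ)
    (hconv : ∀ x, Convex ℝ (φ x)) {ε : ℝ} (hε : 0 < ε) {g : X → E} (hgc : Continuous g)
    {r : ℝ} (hr : 0 < r) {f : X → E} (hf : Continuous f) (hfg : ∀ x, dist (f x) (g x) ≤ ε)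
    (hfr : ∀ x, f x ∈ Metric.thickening r (φ x ∩ Metric.ball (g x) ε)) :
    ∃ f' : X → E, (Continuous f' ∧ (∀ x, dist (f' x) (g x) ≤ ε) ∧
      ∀ x, f' x ∈ Metric.thickening (r / 2) (φ x ∩ Metric.ball (g x) ε)) ∧
      ∀ x, dist (f x) (f' x) ≤ 2 * r := by
  -- Approximation and retraction cost `r / 4` each, hence `r / 2` in total.
  have hδ : 0 < r / 4 := by positivity
  obtain ⟨f₁, hf₁, h₁⟩ := ((hlsc.inter_ball hgc ε).inter_ball hf r).exists_continuous_mem_thickening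
    (fun x => by
      obtain ⟨y, hy, hyr⟩ := Metric.mem_thickening_iff.1 (hfr x)
      exact ⟨y, hy, Metric.mem_ball'.2 hyr⟩)
    (fun x => ((hconv x).inter (convex_ball _ _)).inter (convex_ball _ _)) hf hδ
    (fun x hx => by
      rcases hφ x with ⟨-, -, hc⟩ | huniv
      · exact ⟨φ x, hc, fun y hy => hy.1.1⟩
      · refine absurd ?_ hx
        have huniv : φ x = univ := huniv
        have hcl : f x ∈ closure (Metric.ball (g x) ε) := by
          rw [closure_ball _ hε.ne']
          exact hfg x
        obtain ⟨y, hy, hyr⟩ := Metric.mem_closure_iff.1 hcl (r / 4) hδ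
        refine Metric.mem_thickening_iff.2 ⟨y, ⟨⟨huniv ▸ mem_univ y, hy⟩, ?_⟩, hyr⟩
        exact Metric.mem_ball'.2 (by linarith))
  have hret : ∀ x, dist (g x + radialRetraction ε (f₁ x - g x)) (f₁ x) ≤ r / 4 := by
    intro x
    obtain ⟨y, ⟨⟨-, hyg⟩, -⟩, hy⟩ := Metric.mem_thickening_iff.1 (h₁ x)
    have hv : ‖f₁ x - g x‖ ≤ ε + r / 4 := by
      rw [← dist_eq_norm]
      have := dist_triangle (f₁ x) y (g x)
      rw [Metric.mem_ball] at hyg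
      linarith
    rw [dist_eq_norm, show g x + radialRetraction ε (f₁ x - g x) - f₁ x =
      radialRetraction ε (f₁ x - g x) - (f₁ x - g x) by abel]
    exact norm_radialRetraction_sub_le hε hδ.le hv
  refine ⟨fun x => g x + radialRetraction ε (f₁ x - g x),
    ⟨hgc.add ((continuous_radialRetraction hε).comp (hf₁.sub hgc)), fun x => ?_, fun x => ?_⟩,
    fun x => ?_⟩
  · rw [dist_eq_norm, add_sub_cancel_left]
    exact norm_radialRetraction_le hε _
  · obtain ⟨y, ⟨hyφ, -⟩, hy⟩ := Metric.mem_thickening_iff.1 (h₁ x)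
    refine Metric.mem_thickening_iff.2 ⟨y, hyφ, ?_⟩
    have := dist_triangle (g x + radialRetraction ε (f₁ x - g x)) (f₁ x) y
    linarith [hret x]
  · obtain ⟨y, ⟨-, hyf⟩, hy⟩ := Metric.mem_thickening_iff.1 (h₁ x)
    have t1 := dist_triangle_left (f x) (g x + radialRetraction ε (f₁ x - g x)) (f₁ x)
    have t2 := dist_triangle_right (f₁ x) (f x) y
    rw [Metric.mem_ball'] at hyf
    have := hret x
    rw [dist_comm] at this
    linarith

theorem proposition4p2
    {E : Type*} [NormedAddCommGroup E] [NormedSpace ℝ E] [CompleteSpace E]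
    {X : Type*} [TopologicalSpace X] [CollectionwiseNormalSpace X]
    (φ : X → Set E) (hφ : ∀ x, φ x ∈ compactMembers' E) (hlsc : IsLSC φ)
    (hconv : ∀ x, Convex ℝ (φ x))
    (ε : ℝ) (hε : 0 < ε) (g : X → E) (hgc : Continuous g) (hg : IsEpsSelection ε g φ) :
    ∃ f : X → E, Continuous f ∧ IsSelection f φ ∧ ∀ x, dist (f x) (g x) ≤ ε := by
  have hne : ∀ x, (φ x).Nonempty := fun x => by
    rcases hφ x with ⟨h, -, -⟩ | h
    · exact h
    · exact (show φ x = univ from h) ▸ univ_nonempty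
  have hclosed : ∀ x, IsClosed (φ x) := fun x => by
    rcases hφ x with ⟨-, h, -⟩ | h
    · exact h
    · exact (show φ x = univ from h) ▸ isClosed_univ
  let P : ℕ → (X → E) → Prop := fun n f => Continuous f ∧ (∀ x, dist (f x) (g x) ≤ ε) ∧
    ∀ x, f x ∈ Metric.thickening (ε / 2 ^ n) (φ x ∩ Metric.ball (g x) ε)
  have hstart : P 0 g := by
    refine ⟨hgc, fun x => by rw [dist_self]; exact hε.le, fun x => ?_⟩
    obtain ⟨y, hy, hyg⟩ := (Metric.infDist_lt_iff (hne x)).1 (hg x)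
    exact Metric.mem_thickening_iff.2 ⟨y, ⟨hy, Metric.mem_ball'.2 hyg⟩, by simpa using hyg⟩
  -- The bound is `2 * (ε / 2 ^ n)`, in the shape required by `cauchySeq_of_le_geometric_two`.
  have hstep : ∀ n (f : {f // P n f}), ∃ f' : {f // P (n + 1) f},
      ∀ x, dist (f.1 x) (f'.1 x) ≤ 4 * ε / 2 / 2 ^ n := by
    rintro n ⟨f, hf, hfg, hfr⟩
    obtain ⟨f', ⟨h1, h2, h3⟩, h4⟩ := exists_closer_approximate_selection hφ hlsc hconv hε hgc
      (by positivity : 0 < ε / 2 ^ n) hf hfg hfr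
    refine ⟨⟨f', h1, h2, fun x => ?_⟩, fun x => (h4 x).trans_eq (by ring)⟩
    rw [pow_succ, ← div_div]
    exact h3 x
  choose next hnext using hstep
  let F : ∀ n, {f // P n f} := fun n => Nat.rec ⟨g, hstart⟩ next n
  have hF : ∀ x n, dist ((F n).1 x) ((F (n + 1)).1 x) ≤ 4 * ε / 2 / 2 ^ n :=
    fun x n => hnext n (F n) x
  choose f hf using fun x => cauchySeq_tendsto_of_complete (cauchySeq_of_le_geometric_two (hF x))
  have hdist : ∀ x n, dist ((F n).1 x) (f x) ≤ 4 * ε / 2 ^ n := fun x n =>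
    dist_le_of_le_geometric_two_of_tendsto (hF x) (hf x) n
  have hlim : ∀ c : ℝ, Filter.Tendsto (fun n : ℕ => c / 2 ^ n) Filter.atTop (𝓝 0) := fun c =>
    tendsto_const_nhds.div_atTop (tendsto_pow_atTop_atTop_of_one_lt one_lt_two)
  refine ⟨f, ?_, fun x => ?_, fun x => ?_⟩
  · have hunif : TendstoUniformly (fun n => (F n).1) f Filter.atTop := by
      refine Metric.tendstoUniformly_iff.2 fun η hη => ?_
      filter_upwards [(hlim (4 * ε)).eventually (gt_mem_nhds hη)] with n hn x
      rw [dist_comm]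
      exact (hdist x n).trans_lt hn
    exact hunif.continuous (Filter.Frequently.of_forall fun n => (F n).2.1)
  · rw [← (hclosed x).closure_eq]
    refine Metric.mem_closure_iff.2 fun η hη => ?_
    -- Five is four for the distance from `F n` to the limit plus one for the distance from `F n` to
    -- `φ x`.
    obtain ⟨n, hn⟩ := ((hlim (5 * ε)).eventually (gt_mem_nhds hη)).exists
    obtain ⟨y, hy, hyF⟩ := Metric.mem_thickening_iff.1 ((F n).2.2.2 x)
    refine ⟨y, hy.1, ?_⟩
    have := dist_triangle_left (f x) y ((F n).1 x)
    have h5 : 5 * ε / 2 ^ n = 4 * ε / 2 ^ n + ε / 2 ^ n := by ring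
    linarith [hdist x n]
  · exact le_of_tendsto ((hf x).dist tendsto_const_nhds)
      (Filter.Eventually.of_forall fun n => (F n).2.2.1 x)
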